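/- For a monic polynomial $p\in\mathbb{C}[x]$ of degree $d$, a point $z=(z_1,\dots,z_d)\in\mathbb{C}^d$ and $1\le i\le d$, put $$q_i(x)=\frac{p(x)}{\prod_{j\neq i}(x-z_j)},\qquad z_i'=z_i-\frac{q_i(z_i)}{q_i'(z_i)}.$$ The Jacobi variant of the Ehrlich–Aberth method for $p$ is the map $\operatorname{JEA}_p\colon z\mapsto(z_1',\dots,z_d')$; we regard it as defined at $z$ if the coordinates of $z$ are pairwise distinct and $q_i'(z_i)\neq0$ for all $i$. Theorem. For every integer $d\ge 4$ there is a monic polynomial $p\in\mathbb{C}[x]$ of degree $d$ with $d$ distinct roots such that $\operatorname{JEA}_p$ has an infinite orbit in $\mathbb{C}^d$ that diverges to infinity: there are points $z^{(n)}\in\mathbb{C}^d$, $n=0,1,2,\dots$, such that for every $n$ the map $\operatorname{JEA}_p$ is defined at $z^{(n)}$ and $\operatorname{JEA}_p(z^{(n)})=z^{(n+1)}$, and $\|z^{(n)}\|\to\infty$ as $n\to\infty$. -/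

import Mathlib

namespace EhrlichAberth

noncomputable section

/-- The rational function `q_i(x) = p(x) / ∏_{j ≠ i} (x - z_j)` of one variable `x`. -/
def q {d : ℕ} (p : Polynomial ℂ) (z : Fin d → ℂ) (i : Fin d) (x : ℂ) : ℂ :=
  p.eval x / ∏ j ∈ Finset.univ.erase i, (x - z j)

/-- The Ehrlich–Aberth update of the `i`-th coordinate: a Newton step for `q_i` at `z_i`. -/
def step {d : ℕ} (p : Polynomial ℂ) (z : Fin d → ℂ) (i : Fin d) : ℂ :=
  z i - q p z i (z i) / deriv (q p z i) (z i)

/-- The Ehrlich–Aberth update of the `i`-th coordinate is defined, with no division by zero: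
`z_i` is no pole of the formula for `q_i`, and `q_i'(z_i) ≠ 0`. -/
def StepDefined {d : ℕ} (p : Polynomial ℂ) (z : Fin d → ℂ) (i : Fin d) : Prop :=
  (∀ j, j ≠ i → z i ≠ z j) ∧ deriv (q p z i) (z i) ≠ 0

/-- The Jacobi variant: all coordinates are updated in parallel. -/
def jacobi {d : ℕ} (p : Polynomial ℂ) (z : Fin d → ℂ) : Fin d → ℂ :=
  fun i => step p z i

/-- `z 0, z 1, z 2, …` is an infinite forward orbit in `ℂ^d` of the Jacobi variant for `p`,
along which every update is defined. -/
def IsJacobiOrbit {d : ℕ} (p : Polynomial ℂ) (z : ℕ → Fin d → ℂ) : Prop :=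
  ∀ n, (∀ i, StepDefined p (z n) i) ∧ z (n + 1) = jacobi p (z n)

end

end EhrlichAberth

open Polynomial Filter Topology

namespace EhrlichAberth

/-! Taking logarithmic derivatives turns one Ehrlich–Aberth step into the equations `AberthRel`,
which are equivariant under Möbius maps. It therefore suffices, in degree 4, to find an orbit in
which some coordinate converges to a finite point without ever reaching it, and to send that point
to infinity. Roots and approximations are taken to be orbits of a Klein four-group of Möbius maps.
The step preserves this symmetry, so it reduces to a rational map of one parameter `t`. The
coefficient 353/60 makes 2 and -2 an attracting 2-cycle of that map. Then |t| tends to 2 without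
reaching it, and `x ↦ 1 / (x - 2)` gives the diverging orbit. Higher degrees follow by adding a root
together with a coordinate that stays on it. -/

/-! ### Logarithmic-derivative form and Möbius equivariance -/

/-- `z'` solves the Ehrlich–Aberth equations for the polynomial with roots `r` at the point `z`. -/
def AberthRel {d : ℕ} (r z z' : Fin d → ℂ) : Prop :=
  ∀ i, ∑ k, 1 / (z i - r k) = ∑ j ∈ Finset.univ.erase i, 1 / (z i - z j) + 1 / (z i - z' i)

/-- The equation says that the logarithmic derivative of `q` at `z i` is `1 / (z i - z' i)`, the
reciprocal of the Newton correction. -/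
theorem AberthRel.stepDefined_and_step_eq {d : ℕ} {r z z' : Fin d → ℂ} (h : AberthRel r z z')
    (hz : Function.Injective z) (i : Fin d) (hr : ∀ k, z i ≠ r k) (hz' : z i ≠ z' i) :
    StepDefined (∏ k, (X - C (r k))) z i ∧ step (∏ k, (X - C (r k))) z i = z' i := by
  have hne : ∀ j ∈ Finset.univ.erase i, z i - z j ≠ 0 := fun j hj =>
    sub_ne_zero.2 fun e => (Finset.ne_of_mem_erase hj) (hz e).symm
  have hq : q (∏ k, (X - C (r k))) z i =
      fun x => (∏ k, (x - r k)) / ∏ j ∈ Finset.univ.erase i, (x - z j) := by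
    funext x
    simp [q, eval_prod]
  have hnum : ∏ k, (z i - r k) ≠ 0 := Finset.prod_ne_zero_iff.2 fun k _ => sub_ne_zero.2 (hr k)
  have hden : ∏ j ∈ Finset.univ.erase i, (z i - z j) ≠ 0 := Finset.prod_ne_zero_iff.2 hne
  have hq0 : q (∏ k, (X - C (r k))) z i (z i) ≠ 0 := by
    rw [hq]; exact div_ne_zero hnum hden
  have hlin : ∀ a x : ℂ, logDeriv (fun y : ℂ => y - a) x = 1 / (x - a) := by
    intro a x
    simp [logDeriv_apply]
  have hlog : logDeriv (q (∏ k, (X - C (r k))) z i) (z i) = 1 / (z i - z' i) := by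
    rw [hq, logDeriv_div (z i) hnum hden (by fun_prop) (by fun_prop),
      logDeriv_prod (f := fun k x => x - r k) (fun k _ => sub_ne_zero.2 (hr k))
        (fun k _ => by fun_prop),
      logDeriv_prod (f := fun k x => x - z k) hne (fun k _ => by fun_prop)]
    simp only [hlin]
    rw [h i]; ring
  have hs : z i - z' i ≠ 0 := sub_ne_zero.2 hz'
  have hder : deriv (q (∏ k, (X - C (r k))) z i) (z i) =
      q (∏ k, (X - C (r k))) z i (z i) / (z i - z' i) := by
    rw [logDeriv_apply, div_eq_iff hq0] at hlog
    rw [hlog]; ring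
  refine ⟨⟨fun j hj e => hj (hz e).symm, ?_⟩, ?_⟩
  · rw [hder]; exact div_ne_zero hq0 hs
  · rw [step, hder, div_div_cancel₀ hq0]; ring

theorem one_div_inv_sub_inv {a b c : ℂ} (ha : a ≠ c) (hb : b ≠ c) (hab : a ≠ b) :
    1 / ((a - c)⁻¹ - (b - c)⁻¹) = -(a - c) ^ 2 * (1 / (a - b)) + (a - c) := by
  have h1 := sub_ne_zero.2 ha
  have h2 := sub_ne_zero.2 hb
  have h3 := sub_ne_zero.2 hab
  rw [inv_sub_inv h1 h2, show b - c - (a - c) = -(a - b) by ring]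
  field_simp
  ring

/-- The Ehrlich–Aberth equations are equivariant under `x ↦ 1 / (x - c)`. -/
theorem AberthRel.inv_sub {d : ℕ} {r z z' : Fin d → ℂ} (h : AberthRel r z z') {c : ℂ}
    (hz : Function.Injective z) (hr : ∀ i k, z i ≠ r k) (hz' : ∀ i, z i ≠ z' i)
    (hrc : ∀ k, r k ≠ c) (hzc : ∀ i, z i ≠ c) (hzc' : ∀ i, z' i ≠ c) :
    AberthRel (fun k => (r k - c)⁻¹) (fun k => (z k - c)⁻¹) (fun k => (z' k - c)⁻¹) := by
  intro i
  have hd : 1 ≤ d := Fin.pos i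
  rw [one_div_inv_sub_inv (hzc i) (hzc' i) (hz' i),
    Finset.sum_congr rfl fun k _ => one_div_inv_sub_inv (hzc i) (hrc k) (hr i k),
    Finset.sum_congr (Eq.refl (Finset.univ.erase i)) fun j hj => one_div_inv_sub_inv (hzc i) (hzc j)
      (fun e => Finset.ne_of_mem_erase hj (hz e).symm),
    Finset.sum_add_distrib, Finset.sum_add_distrib, ← Finset.mul_sum, ← Finset.mul_sum, h i]
  simp only [Finset.sum_const, Finset.card_erase_of_mem (Finset.mem_univ i), Finset.card_univ,
    Fintype.card_fin, nsmul_eq_mul]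
  -- The extra terms `z i - c` balance: `d` on the left, `(d - 1) + 1` on the right.
  push_cast [hd]
  ring

/-! ### Raising the degree by one -/

/-- A coordinate sitting on a new simple root `a` is fixed by its Newton step, and its factor `x -
a` cancels from every other `q`. -/
theorem exists_orbit_succ {d : ℕ} {p : ℂ[X]} (hp : p.Monic) (hd : p.natDegree = d)
    (hroots : p.roots.Nodup) {z : ℕ → Fin d → ℂ} (hz : IsJacobiOrbit p z)
    (hlim : Tendsto (fun n => ‖z n‖) atTop atTop) :
    ∃ p : ℂ[X], p.Monic ∧ p.natDegree = d + 1 ∧ p.roots.Nodup ∧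
      ∃ z : ℕ → Fin (d + 1) → ℂ, IsJacobiOrbit p z ∧
        Tendsto (fun n => ‖z n‖) atTop atTop := by
  have hcount : (Set.range (fun x : ℕ × Fin d => z x.1 x.2) ∪ {x | x ∈ p.roots}).Countable := by
    refine (Set.countable_range _).union (Set.Finite.countable ?_)
    exact p.roots.finite_toSet
  obtain ⟨a, ha⟩ : ∃ a, a ∉ Set.range (fun x : ℕ × Fin d => z x.1 x.2) ∪ {x | x ∈ p.roots} := by
    by_contra! hall
    exact not_countable_complex (hcount.mono fun x _ => hall x)
  have haz : ∀ n i, z n i ≠ a := fun n i e => ha (Or.inl ⟨(n, i), e⟩)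
  have har : a ∉ p.roots := fun e => ha (Or.inr e)
  have hap : p.eval a ≠ 0 := fun e => har ((mem_roots hp.ne_zero).2 e)
  have hmul : (p * (X - C a)).Monic := hp.mul (monic_X_sub_C a)
  have hq_succ : ∀ n i x, x ≠ a →
      q (p * (X - C a)) (Fin.cons a (z n) : Fin (d + 1) → ℂ) (Fin.succ i) x = q p (z n) i x := by
    intro n i x hx
    have hs : (Finset.univ.erase (Fin.succ i) : Finset (Fin (d + 1))) =
        insert 0 ((Finset.univ.erase i).map (Fin.succEmb d)) := by
      ext j
      refine Fin.cases ?_ (fun j => ?_) j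
      · simp [(Fin.succ_ne_zero i).symm]
      · simp [Fin.succ_ne_zero]
    have hx' := sub_ne_zero.2 hx
    rw [q, q, hs, Finset.prod_insert (by simp [Fin.succ_ne_zero]), Finset.prod_map]
    simp only [Fin.cons_zero, Fin.coe_succEmb, Fin.cons_succ, eval_mul, eval_sub, eval_X, eval_C]
    rw [mul_comm (eval x p), mul_div_mul_left _ _ hx']
  have hq_zero : ∀ n, q (p * (X - C a)) (Fin.cons a (z n) : Fin (d + 1) → ℂ) 0 =
      fun x => (x - a) * (p.eval x / ∏ j, (x - z n j)) := by
    intro n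
    funext x
    have hs : (Finset.univ.erase 0 : Finset (Fin (d + 1))) = Finset.univ.map (Fin.succEmb d) := by
      ext j
      refine Fin.cases ?_ (fun j => ?_) j
      · simp
      · simp [Fin.succ_ne_zero]
    rw [q, hs, Finset.prod_map]
    simp only [Fin.coe_succEmb, Fin.cons_succ, eval_mul, eval_sub, eval_X, eval_C]
    ring
  have hprod : ∀ n, ∏ j, (a - z n j) ≠ 0 := fun n =>
    Finset.prod_ne_zero_iff.2 fun j _ => sub_ne_zero.2 (haz n j).symm
  have hderiv_zero : ∀ n,
      deriv (q (p * (X - C a)) (Fin.cons a (z n) : Fin (d + 1) → ℂ) 0) a ≠ 0 := by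
    intro n
    have hg : DifferentiableAt ℂ (fun x => p.eval x / ∏ j, (x - z n j)) a :=
      p.differentiableAt.div (by fun_prop) (hprod n)
    have := ((hasDerivAt_id a).sub_const a).mul hg.hasDerivAt
    rw [hq_zero]
    have h2 : deriv (fun x => (x - a) * (p.eval x / ∏ j, (x - z n j))) a = _ := this.deriv
    rw [h2]
    simpa using ⟨hap, hprod n⟩
  have hderiv_succ : ∀ n i,
      deriv (q (p * (X - C a)) (Fin.cons a (z n) : Fin (d + 1) → ℂ) (Fin.succ i)) (z n i) =
        deriv (q p (z n) i) (z n i) := by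
    intro n i
    -- The cancellation fails at `x = a`, so the two functions agree only near `z n i`.
    refine Filter.EventuallyEq.deriv_eq ?_
    filter_upwards [isOpen_ne.mem_nhds (haz n i)] with x hx
    exact hq_succ n i x hx
  refine ⟨p * (X - C a), hmul, ?_, ?_, fun n => Fin.cons a (z n), ?_, ?_⟩
  · rw [hp.natDegree_mul (monic_X_sub_C a), hd, natDegree_X_sub_C]
  · rw [roots_mul hmul.ne_zero, roots_X_sub_C, add_comm, Multiset.singleton_add,
      Multiset.nodup_cons]
    exact ⟨har, hroots⟩
  · intro n
    obtain ⟨hdef, hstep⟩ := hz n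
    constructor
    · intro i
      refine Fin.cases ⟨fun j => ?_, ?_⟩ (fun i => ⟨fun j => ?_, ?_⟩) i
      · refine Fin.cases (fun h => (h rfl).elim) (fun j _ => ?_) j
        simpa using (haz n j).symm
      · simpa using hderiv_zero n
      · refine Fin.cases (fun _ => ?_) (fun j hj => ?_) j
        · simpa using haz n i
        · simpa using (hdef i).1 j (fun e => hj (by rw [e]))
      · simpa [hderiv_succ] using (hdef i).2
    · funext i
      refine Fin.cases ?_ (fun i => ?_) i
      · simp [jacobi, step, hq_zero]
      · simp only [Fin.cons_succ, jacobi, step]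
        rw [hderiv_succ, hq_succ n i _ (haz n i), hstep]
        rfl
  · refine tendsto_atTop_mono (fun n => ?_) hlim
    refine (pi_norm_le_iff_of_nonneg (norm_nonneg _)).2 fun i => ?_
    simpa using norm_le_pi_norm (Fin.cons a (z n) : Fin (d + 1) → ℂ) (Fin.succ i)

/-! ### Configurations with Klein four-group symmetry -/

/-- The orbit of `t` under the Klein four-group generated by `x ↦ -x` and `x ↦ I / x`. -/
noncomputable def kleinOrbit (t : ℂ) : Fin 4 → ℂ := ![t, -t, Complex.I / t, -(Complex.I / t)]

theorem one_div_I_div_sub_I_div {a b : ℂ} (ha : a ≠ 0) (hb : b ≠ 0) (hab : a ≠ b) :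
    1 / (Complex.I / a - Complex.I / b) =
      Complex.I * a ^ 2 * (1 / (a - b)) - Complex.I * a := by
  have h3 := sub_ne_zero.2 hab
  have h4 : b - a ≠ 0 := sub_ne_zero.2 hab.symm
  have hI := Complex.I_ne_zero
  have : Complex.I / a - Complex.I / b = Complex.I * (b - a) / (a * b) := by
    field_simp
  rw [this, show b - a = -(a - b) by ring]
  field_simp
  rw [Complex.I_sq]
  ring

/-- By equivariance under the group, the equation at `t` yields those at the other three points. -/
theorem aberthRel_kleinOrbit_of_zero {R t t' : ℂ} (hR : R ≠ 0) (ht : t ≠ 0) (ht' : t' ≠ 0)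
    (hinj : Function.Injective (kleinOrbit t)) (hr : ∀ k, t ≠ kleinOrbit R k) (htt' : t ≠ t')
    (h : 1 / (t - R) + 1 / (t + R) + 1 / (t - Complex.I / R) + 1 / (t + Complex.I / R) =
      1 / (t + t) + 1 / (t - Complex.I / t) + 1 / (t + Complex.I / t) + 1 / (t - t')) :
    AberthRel (kleinOrbit R) (kleinOrbit t) (kleinOrbit t') := by
  have e0 : t ≠ R := hr 0
  have e1 : t ≠ -R := hr 1
  have e2 : t ≠ Complex.I / R := hr 2
  have e3 : t ≠ -(Complex.I / R) := hr 3
  have f1 : t ≠ -t := hinj.ne (show (0 : Fin 4) ≠ 1 by decide)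
  have f2 : t ≠ Complex.I / t := hinj.ne (show (0 : Fin 4) ≠ 2 by decide)
  have f3 : t ≠ -(Complex.I / t) := hinj.ne (show (0 : Fin 4) ≠ 3 by decide)
  have hI := Complex.I_ne_zero
  have key := fun b hb hab => one_div_I_div_sub_I_div (a := t) (b := b) ht hb hab
  have hII : ∀ x : ℂ, Complex.I / (Complex.I / x) = x := fun x => div_div_cancel₀ hI
  have neg_form : ∀ a b : ℂ, 1 / (-a - b) = -(1 / (a - -b)) := fun a b => by
    rw [show -a - b = -(a - -b) by ring, one_div_neg_eq_neg_one_div]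
  have neg_form' : ∀ a b : ℂ, 1 / (-a + b) = -(1 / (a - b)) := fun a b => by
    rw [show -a + b = -(a - b) by ring, one_div_neg_eq_neg_one_div]
  have g0 := key R hR e0
  have g1 := key (-R) (neg_ne_zero.2 hR) e1
  have g2 := key _ (div_ne_zero hI hR) e2
  have g3 := key _ (neg_ne_zero.2 (div_ne_zero hI hR)) e3
  have k1 := key (-t) (neg_ne_zero.2 ht) f1
  have k2 := key _ (div_ne_zero hI ht) f2
  have k3 := key _ (neg_ne_zero.2 (div_ne_zero hI ht)) f3
  have k' := key t' ht' htt'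
  simp only [div_neg, hII] at g0 g1 g2 g3 k1 k2 k3 k'
  simp only [sub_neg_eq_add] at g0 g1 g2 g3 k1 k2 k3 k'
  have hinvl : 1 / (Complex.I / t - R) + 1 / (Complex.I / t + R) +
      1 / (Complex.I / t - Complex.I / R) + 1 / (Complex.I / t + Complex.I / R) =
      1 / (Complex.I / t + Complex.I / t) + 1 / (Complex.I / t - t) + 1 / (Complex.I / t + t)
        + 1 / (Complex.I / t - Complex.I / t') := by
    rw [g0, g1, g2, g3, k1, k2, k3, k']
    linear_combination (Complex.I * t ^ 2) * h
  have er0 : (Finset.univ.erase (0 : Fin 4)) = {1, 2, 3} := by decide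
  have er1 : (Finset.univ.erase (1 : Fin 4)) = {0, 2, 3} := by decide
  have er2 : (Finset.univ.erase (2 : Fin 4)) = {0, 1, 3} := by decide
  have er3 : (Finset.univ.erase (3 : Fin 4)) = {0, 1, 2} := by decide
  intro i
  fin_cases i
  · simp only [Fin.zero_eta, er0, kleinOrbit, Fin.sum_univ_four]
    simp [-one_div]
    linear_combination h
  · simp only [Fin.mk_one, er1, kleinOrbit, Fin.sum_univ_four]
    simp [-one_div, neg_form, neg_form']
    linear_combination -h
  · simp only [Fin.reduceFinMk, er2, kleinOrbit, Fin.sum_univ_four]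
    simp [-one_div]
    linear_combination hinvl
  · simp only [Fin.reduceFinMk, er3, kleinOrbit, Fin.sum_univ_four]
    simp [-one_div, neg_form, neg_form']
    linear_combination -hinvl

/-- The Ehrlich–Aberth equation for the symmetric configuration reduces to a rational map of `t`. -/
theorem aberth_equation_kleinOrbit {R κ t : ℂ} (hR : R ≠ 0) (hκ : R ^ 4 + κ * R ^ 2 = 1)
    (ht : t ≠ 0) (h1 : t ^ 4 + 1 ≠ 0) (hp : t ^ 4 + κ * t ^ 2 - 1 ≠ 0)
    (hD : 3 * t ^ 8 - κ * t ^ 6 + 12 * t ^ 4 + 3 * κ * t ^ 2 + 1 ≠ 0) :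
    1 / (t - R) + 1 / (t + R) + 1 / (t - Complex.I / R) + 1 / (t + Complex.I / R) =
      1 / (t + t) + 1 / (t - Complex.I / t) + 1 / (t + Complex.I / t) + 1 / (t -
        t * (t ^ 8 - 3 * κ * t ^ 6 + 12 * t ^ 4 + κ * t ^ 2 + 3) /
          (3 * t ^ 8 - κ * t ^ 6 + 12 * t ^ 4 + 3 * κ * t ^ 2 + 1)) := by
  have hR2 : R ^ 2 ≠ 0 := pow_ne_zero 2 hR
  -- With `hκ`, the roots of `x ^ 4 + κ * x ^ 2 - 1` are `±R` and `±I / R`.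
  have hfac : R ^ 2 * (t ^ 4 + κ * t ^ 2 - 1) = (t ^ 2 - R ^ 2) * (R ^ 2 * t ^ 2 + 1) := by
    linear_combination (t ^ 2) * hκ
  have hne := mul_ne_zero hR2 hp
  rw [hfac] at hne
  have pair : ∀ x y : ℂ, x ^ 2 - y ^ 2 ≠ 0 → 1 / (x - y) + 1 / (x + y) = 2 * x / (x ^ 2 - y ^ 2) := by
    intro x y hxy
    have hh : (x - y) * (x + y) ≠ 0 := by convert hxy using 1; ring
    have ha := left_ne_zero_of_mul hh
    have hb := right_ne_zero_of_mul hh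
    rw [show x ^ 2 - y ^ 2 = (x - y) * (x + y) by ring]
    field_simp
    ring
  have hsq : ∀ x : ℂ, (Complex.I / x) ^ 2 = -(1 / x ^ 2) := by
    intro x; rw [div_pow, Complex.I_sq]; ring
  have ha : t ^ 2 - R ^ 2 ≠ 0 := left_ne_zero_of_mul hne
  have hb : R ^ 2 * t ^ 2 + 1 ≠ 0 := right_ne_zero_of_mul hne
  have hb' : t ^ 2 - (Complex.I / R) ^ 2 = (R ^ 2 * t ^ 2 + 1) / R ^ 2 := by
    rw [hsq]; field_simp; ring
  have hc' : t ^ 2 - (Complex.I / t) ^ 2 = (t ^ 4 + 1) / t ^ 2 := by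
    rw [hsq]; field_simp; ring
  have hsub : t - t * (t ^ 8 - 3 * κ * t ^ 6 + 12 * t ^ 4 + κ * t ^ 2 + 3) /
      (3 * t ^ 8 - κ * t ^ 6 + 12 * t ^ 4 + 3 * κ * t ^ 2 + 1) =
      2 * t * (t ^ 4 + 1) * (t ^ 4 + κ * t ^ 2 - 1) /
        (3 * t ^ 8 - κ * t ^ 6 + 12 * t ^ 4 + 3 * κ * t ^ 2 + 1) := by
    rw [eq_div_iff hD, sub_mul, div_mul_cancel₀ _ hD]; ring
  have hroots : 2 * t / (t ^ 2 - R ^ 2) + 2 * t / ((R ^ 2 * t ^ 2 + 1) / R ^ 2) =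
      (4 * t ^ 3 + 2 * κ * t) / (t ^ 4 + κ * t ^ 2 - 1) := by
    have : t ^ 4 + κ * t ^ 2 - 1 = (t ^ 2 - R ^ 2) * (R ^ 2 * t ^ 2 + 1) / R ^ 2 := by
      rw [← hfac]; field_simp
    rw [this, div_div_eq_mul_div, div_div_eq_mul_div, div_add_div _ _ ha hb,
      div_eq_div_iff (mul_ne_zero ha hb) (mul_ne_zero ha hb)]
    linear_combination (-2 * t * (t ^ 2 - R ^ 2) * (R ^ 2 * t ^ 2 + 1)) * hκ
  have hbR : t ^ 2 - (Complex.I / R) ^ 2 ≠ 0 := hb' ▸ div_ne_zero hb hR2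
  have hct : t ^ 2 - (Complex.I / t) ^ 2 ≠ 0 := hc' ▸ div_ne_zero h1 (pow_ne_zero 2 ht)
  rw [hsub, pair _ _ ha, add_assoc, pair _ _ hbR, add_assoc (1 / (t + t)), pair _ _ hct, hb', hc',
    hroots, ← two_mul, one_div_div]
  have h2t : 2 * t ≠ 0 := mul_ne_zero two_ne_zero ht
  have h2 : 2 * t * (t ^ 4 + 1) * (t ^ 4 + κ * t ^ 2 - 1) ≠ 0 := mul_ne_zero (mul_ne_zero h2t h1) hp
  rw [div_div_eq_mul_div, div_add_div _ _ h2t h1, div_add_div _ _ (mul_ne_zero h2t h1) h2,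
    div_eq_div_iff hp (mul_ne_zero (mul_ne_zero h2t h1) h2)]
  ring

theorem kleinOrbit_ofReal (t : ℝ) :
    kleinOrbit (t : ℂ) = ![⟨t, 0⟩, ⟨-t, 0⟩, ⟨0, t⁻¹⟩, ⟨0, -t⁻¹⟩] := by
  have h : Complex.I / (t : ℂ) = ⟨0, t⁻¹⟩ := by
    rw [div_eq_mul_inv, ← Complex.ofReal_inv]
    apply Complex.ext <;> simp
  rw [kleinOrbit, h]
  congr 1
  congr 1
  · apply Complex.ext <;> simp
  · congr 2
    apply Complex.ext <;> simp

theorem kleinOrbit_ofReal_injective {t : ℝ} (ht : t ≠ 0) :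
    Function.Injective (kleinOrbit (t : ℂ)) := by
  have h1 : t ≠ -t := fun h => ht (by linarith)
  have h2 : t⁻¹ ≠ -t⁻¹ := fun h => inv_ne_zero ht (by linarith)
  rw [kleinOrbit_ofReal]
  intro i j hij
  fin_cases i <;> fin_cases j <;> simp_all [Complex.ext_iff, eq_comm]

theorem kleinOrbit_ofReal_ne {s t : ℝ} (hs : s ≠ 0) (ht : t ≠ 0) (h : |s| ≠ |t|) (i j : Fin 4) :
    kleinOrbit (s : ℂ) i ≠ kleinOrbit (t : ℂ) j := by
  have h1 : s ≠ t := fun e => h (by rw [e])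
  have h2 : s ≠ -t := fun e => h (by rw [e, abs_neg])
  have h3 : -s ≠ t := fun e => h2 (by rw [← e, neg_neg])
  have h4 : s⁻¹ ≠ -t⁻¹ := fun e => h2 (inv_injective (by rw [e, inv_neg]))
  have h5 : -s⁻¹ ≠ t⁻¹ := fun e => h4 (by rw [← e, neg_neg])
  rw [kleinOrbit_ofReal, kleinOrbit_ofReal]
  fin_cases i <;> fin_cases j <;> simp_all [Complex.ext_iff]

theorem kleinOrbit_ofReal_ne_two {t : ℝ} (h : |t| ≠ 2) (i : Fin 4) :
    kleinOrbit (t : ℂ) i ≠ 2 := by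
  have h1 : t ≠ 2 := fun e => h (by rw [e]; norm_num)
  have h2 : -t ≠ 2 := fun e => h (by rw [← abs_neg, e]; norm_num)
  rw [kleinOrbit_ofReal]
  fin_cases i <;> simp_all [Complex.ext_iff]

theorem kleinOrbit_apply_ne {s t : ℂ} (h : s ≠ t) (i : Fin 4) :
    kleinOrbit s i ≠ kleinOrbit t i := by
  have h1 : Complex.I / s ≠ Complex.I / t := fun e => h (by
    simpa [div_eq_mul_inv, Complex.I_ne_zero] using e)
  fin_cases i <;> simp [kleinOrbit, h, h1]

/-! ### The real one-parameter map and its attracting 2-cycle -/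

/-- Denominator of the map induced on the symmetric configurations by `x ^ 4 + 353/60 x ^ 2 - 1`. -/
noncomputable def kleinDen (t : ℝ) : ℝ :=
  3 * t ^ 8 - 353 / 60 * t ^ 6 + 12 * t ^ 4 + 3 * (353 / 60) * t ^ 2 + 1

/-- The map induced on the symmetric configurations by `x ^ 4 + 353/60 x ^ 2 - 1`. -/
noncomputable def kleinMap (t : ℝ) : ℝ :=
  t * (t ^ 8 - 3 * (353 / 60) * t ^ 6 + 12 * t ^ 4 + 353 / 60 * t ^ 2 + 3) / kleinDen t

theorem kleinDen_pos (t : ℝ) : 0 < kleinDen t := by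
  unfold kleinDen
  -- 353/360 completes the square in the two leading terms.
  nlinarith [sq_nonneg (t ^ 4 - 353 / 360 * t ^ 2), sq_nonneg (t ^ 2), sq_nonneg t]

theorem abs_kleinMap (t : ℝ) : |kleinMap t| = |kleinMap (|t|)| := by
  rcases abs_choice t with h | h
  · rw [h]
  · have : kleinMap (-t) = -kleinMap t := by
      simp only [kleinMap, kleinDen, Even.neg_pow (show Even 8 by decide),
        Even.neg_pow (show Even 6 by decide), Even.neg_pow (show Even 4 by decide),
        even_two.neg_pow]
      ring
    rw [h, this, abs_neg]

theorem exists_kleinMap_contracts : ∃ δ : ℝ, 0 < δ ∧ δ ≤ 1 / 2 ∧ ∀ t : ℝ, |t| ≠ 2 →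
    |(|t| - 2)| ≤ δ → |kleinMap t| ≠ 2 ∧ |(|kleinMap t| - 2)| ≤ 1 / 2 * |(|t| - 2)| := by
  -- `H` is the difference quotient of `-kleinMap` at 2, where `-kleinMap` is fixed precisely
  -- because the coefficient is 353/60. Its value `H 2 ≈ -0.34` is the multiplier: size below 1/2
  -- gives contraction, and being nonzero keeps |t| off 2.
  set H : ℝ → ℝ := fun t => (1 + 2 * t + 373 / 20 * t ^ 2 + 184 / 15 * t ^ 3 + 272 / 15 * t ^ 4 +
    226 / 15 * t ^ 5 + 33 / 20 * t ^ 6 - 8 * t ^ 7 - t ^ 8) / kleinDen t with hH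
  have hmap : ∀ t, kleinMap t = -(2 + (t - 2) * H t) := by
    intro t
    have hD := (kleinDen_pos t).ne'
    rw [hH, kleinMap, div_eq_iff hD, neg_mul, add_mul, mul_assoc (t - 2), div_mul_cancel₀ _ hD,
      kleinDen]
    ring
  have hcont : ContinuousAt H 2 := by
    refine ContinuousAt.div (by fun_prop) ?_ (kleinDen_pos 2).ne'
    unfold kleinDen
    fun_prop
  have hmem : Set.Ioo (-1 / 2 : ℝ) 0 ∈ 𝓝 (H 2) :=
    Ioo_mem_nhds (by norm_num [hH, kleinDen]) (by norm_num [hH, kleinDen])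
  obtain ⟨ε, hε, hball⟩ := Metric.eventually_nhds_iff.1 (hcont.eventually_mem hmem)
  refine ⟨min (ε / 2) (1 / 2), by positivity, min_le_right _ _, fun t ht hle => ?_⟩
  have hHt := hball (y := |t|) (by
    rw [Real.dist_eq]
    linarith [min_le_left (ε / 2) (1 / 2)])
  have habs : |H (|t|)| ≤ 1 / 2 := abs_le.2 ⟨by linarith [hHt.1], by linarith [hHt.2]⟩
  have hmul : |(|t| - 2) * H (|t|)| ≤ 1 / 2 * |(|t| - 2)| := by
    rw [abs_mul, mul_comm]
    exact mul_le_mul_of_nonneg_right habs (abs_nonneg _)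
  have hne : (|t| - 2) * H (|t|) ≠ 0 := mul_ne_zero (sub_ne_zero.2 ht) hHt.2.ne
  have hval : |kleinMap t| = 2 + (|t| - 2) * H (|t|) := by
    rw [abs_kleinMap, hmap, abs_neg, abs_of_pos]
    linarith [min_le_right (ε / 2) (1 / 2), (abs_le.1 hmul).1]
  rw [hval, add_sub_cancel_left]
  exact ⟨fun h => hne (by linarith), hmul⟩

theorem exists_root_param : ∃ R : ℝ, 0 < R ∧ R < 1 ∧ R ^ 4 + 353 / 60 * R ^ 2 = 1 := by
  have hc : ContinuousOn (fun x : ℝ => x ^ 4 + 353 / 60 * x ^ 2) (Set.Icc 0 1) := by fun_prop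
  obtain ⟨R, hR, h⟩ := intermediate_value_Icc zero_le_one hc
    (show (1 : ℝ) ∈ Set.Icc _ _ by norm_num)
  simp only at h
  refine ⟨R, lt_of_le_of_ne hR.1 ?_, lt_of_le_of_ne hR.2 ?_, h⟩
  · rintro rfl; norm_num at h
  · rintro rfl; norm_num at h

theorem aberthRel_kleinMap {R : ℝ} (hR : 0 < R) (hR1 : R < 1)
    (hκ : R ^ 4 + 353 / 60 * R ^ 2 = 1) {t : ℝ} (ht : 3 / 2 ≤ |t|) (ht' : kleinMap t ≠ 0) :
    AberthRel (kleinOrbit (R : ℂ)) (kleinOrbit (t : ℂ)) (kleinOrbit (kleinMap t : ℂ)) ∧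
      t ≠ kleinMap t := by
  have ht0 : t ≠ 0 := by rintro rfl; norm_num at ht
  have hsq : 9 / 4 ≤ t ^ 2 := by rw [← sq_abs]; nlinarith
  have h1 : t ^ 4 + 1 ≠ 0 := by positivity
  have hp : t ^ 4 + 353 / 60 * t ^ 2 - 1 ≠ 0 := by
    have : 0 ≤ t ^ 4 := by positivity
    intro h; linarith
  have hD := (kleinDen_pos t).ne'
  have hne : t ≠ kleinMap t := by
    have : t - kleinMap t = 2 * t * (t ^ 4 + 1) * (t ^ 4 + 353 / 60 * t ^ 2 - 1) / kleinDen t := by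
      rw [kleinMap, eq_div_iff hD, sub_mul, div_mul_cancel₀ _ hD, kleinDen]; ring
    rw [← sub_ne_zero, this]
    positivity
  have habs : |t| ≠ |R| := by rw [abs_of_pos hR]; linarith
  refine ⟨aberthRel_kleinOrbit_of_zero (by exact_mod_cast hR.ne') (by exact_mod_cast ht0)
    (by exact_mod_cast ht') (kleinOrbit_ofReal_injective ht0)
    (kleinOrbit_ofReal_ne ht0 hR.ne' habs 0) (by exact_mod_cast hne) ?_, hne⟩
  have := aberth_equation_kleinOrbit (R := R) (κ := (353 / 60 : ℝ)) (t := t)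
    (by exact_mod_cast hR.ne') (by exact_mod_cast hκ) (by exact_mod_cast ht0)
    (by exact_mod_cast h1) (by exact_mod_cast hp)
    (by rw [kleinDen] at hD; exact_mod_cast hD)
  rw [this, kleinMap, kleinDen]
  push_cast
  rfl

/-! ### The diverging orbit in degree 4 -/

theorem exists_diverging_orbit_four :
    ∃ p : ℂ[X], p.Monic ∧ p.natDegree = 4 ∧ p.roots.Nodup ∧
      ∃ z : ℕ → Fin 4 → ℂ, IsJacobiOrbit p z ∧ Tendsto (fun n => ‖z n‖) atTop atTop := by
  obtain ⟨R, hR, hR1, hκ⟩ := exists_root_param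
  obtain ⟨δ, hδ, hδ2, hδt⟩ := exists_kleinMap_contracts
  set τ : ℕ → ℝ := fun n => kleinMap^[n] (2 + δ) with hτ
  have hsucc : ∀ n, τ (n + 1) = kleinMap (τ n) := fun n => Function.iterate_succ_apply' _ _ _
  have hinv : ∀ n, |τ n| ≠ 2 ∧ |(|τ n| - 2)| ≤ (1 / 2) ^ n * δ := by
    intro n
    induction n with
    | zero =>
      have : |τ 0| = 2 + δ := abs_of_pos (by simp [hτ]; linarith)
      rw [this]
      refine ⟨by linarith, ?_⟩
      rw [abs_of_nonneg (by linarith)]; simp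
    | succ n ih =>
      have hle : (1 / 2 : ℝ) ^ n * δ ≤ δ :=
        mul_le_of_le_one_left hδ.le (pow_le_one₀ (by norm_num) (by norm_num))
      obtain ⟨h1, h2⟩ := hδt (τ n) ih.1 (ih.2.trans hle)
      rw [hsucc]
      refine ⟨h1, h2.trans ?_⟩
      rw [pow_succ]
      linarith [ih.2]
  have hbound : ∀ n, 3 / 2 ≤ |τ n| := by
    intro n
    have hle : (1 / 2 : ℝ) ^ n * δ ≤ δ :=
      mul_le_of_le_one_left hδ.le (pow_le_one₀ (by norm_num) (by norm_num))
    have := (abs_le.1 (hinv n).2).1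
    linarith
  have hne0 : ∀ n, τ n ≠ 0 := fun n h => by have := hbound n; rw [h] at this; norm_num at this
  have hRabs : |R| ≠ 2 := by rw [abs_of_pos hR]; linarith
  have hroot_inj : Function.Injective fun k => (kleinOrbit (R : ℂ) k - 2)⁻¹ :=
    inv_injective.comp ((sub_left_injective).comp (kleinOrbit_ofReal_injective hR.ne'))
  refine ⟨∏ k, (X - C ((kleinOrbit (R : ℂ) k - 2)⁻¹)), monic_prod_X_sub_C _ _, ?_, ?_,
    fun n k => (kleinOrbit (τ n : ℂ) k - 2)⁻¹, ?_, ?_⟩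
  · rw [natDegree_finsetProd_X_sub_C_eq_card]; simp
  · rw [show ∏ k, (X - C ((kleinOrbit (R : ℂ) k - 2)⁻¹)) = ((Finset.univ.val.map fun k =>
      (kleinOrbit (R : ℂ) k - 2)⁻¹).map fun a => X - C a).prod by
        rw [Multiset.map_map]; rfl, roots_multiset_prod_X_sub_C]
    exact Finset.univ.nodup.map hroot_inj
  · intro n
    have ht' : kleinMap (τ n) ≠ 0 := hsucc n ▸ hne0 (n + 1)
    obtain ⟨hrel, hne⟩ := aberthRel_kleinMap hR hR1 hκ (hbound n) ht'
    have hzr : ∀ i k, kleinOrbit (τ n : ℂ) i ≠ kleinOrbit (R : ℂ) k :=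
      kleinOrbit_ofReal_ne (hne0 n) hR.ne' (by rw [abs_of_pos hR]; linarith [hbound n])
    have hzz : ∀ i, kleinOrbit (τ n : ℂ) i ≠ kleinOrbit (kleinMap (τ n) : ℂ) i :=
      kleinOrbit_apply_ne (by exact_mod_cast hne)
    have hinj := kleinOrbit_ofReal_injective (hne0 n)
    have h := hrel.inv_sub (c := 2) hinj hzr hzz (kleinOrbit_ofReal_ne_two hRabs)
      (kleinOrbit_ofReal_ne_two (hinv n).1)
      (kleinOrbit_ofReal_ne_two (hsucc n ▸ (hinv (n + 1)).1))
    have hstep := fun i => h.stepDefined_and_step_eq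
      (inv_injective.comp (sub_left_injective.comp hinj)) i
      (fun k e => hzr i k (sub_left_injective (inv_injective e)))
      (fun e => hzz i (sub_left_injective (inv_injective e)))
    refine ⟨fun i => (hstep i).1, ?_⟩
    funext i
    simp only [hsucc]
    exact (hstep i).2.symm
  · have hlim : Tendsto (fun n => |(|τ n| - 2)|) atTop (𝓝[>] 0) := by
      refine tendsto_nhdsWithin_iff.2 ⟨?_, Eventually.of_forall fun n =>
        abs_pos.2 (sub_ne_zero.2 (hinv n).1)⟩
      refine squeeze_zero (fun n => abs_nonneg _) (fun n => (hinv n).2) ?_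
      simpa using (tendsto_pow_atTop_nhds_zero_of_lt_one (by norm_num : (0 : ℝ) ≤ 1 / 2)
        (by norm_num)).mul_const δ
    refine tendsto_atTop_mono (fun n => ?_) hlim.inv_tendsto_nhdsGT_zero
    -- The sign of `τ n` decides which of `t`, `-t` is the coordinate near 2; its image under `x ↦ 1
    -- / (x - 2)` is the large one.
    have hco : ∃ i, kleinOrbit (τ n : ℂ) i = ((|τ n| : ℝ) : ℂ) := by
      rcases abs_choice (τ n) with h | h
      · exact ⟨0, by rw [h]; rfl⟩
      · exact ⟨1, by rw [h, Complex.ofReal_neg]; rfl⟩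
    obtain ⟨i, hi⟩ := hco
    refine le_trans (le_of_eq ?_) (norm_le_pi_norm _ i)
    simp only [Pi.inv_apply]
    rw [hi, norm_inv, ← Complex.ofReal_ofNat, ← Complex.ofReal_sub,
      Complex.norm_real, Real.norm_eq_abs]

end EhrlichAberth

theorem theorem1 (d : ℕ) (hd : 4 ≤ d) :
    ∃ p : Polynomial ℂ, p.Monic ∧ p.natDegree = d ∧ p.roots.Nodup ∧
      ∃ z : ℕ → Fin d → ℂ, EhrlichAberth.IsJacobiOrbit p z ∧
        Filter.Tendsto (fun n => ‖z n‖) Filter.atTop Filter.atTop := by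
  induction d, hd using Nat.le_induction with
  | base => exact EhrlichAberth.exists_diverging_orbit_four
  | succ d _ ih =>
    obtain ⟨p, hp, hpd, hroots, z, hz, hlim⟩ := ih
    exact EhrlichAberth.exists_orbit_succ hp hpd hroots hz hlim
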